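/- Let $\mathbf{k}$ be a unitary commutative ring of characteristic zero, $\lambda\in\mathbf{k}$, and $(X,\le)$ a well-ordered set. **Words.** Let $\mathfrak{S}(X)$ be the free operated semigroup on $X$: its elements are the nonempty finite products of primes, a prime being a letter $x\in X$ or a bracket $\lfloor u\rfloor$ with $u\in\mathfrak{S}(X)$; the breadth $|w|$ is the number of prime factors of $w$. Let $\mathbf{k}\mathfrak{S}(X)$ be the free module on $\mathfrak{S}(X)$ with the bilinear product and the linear operator $P$ extending $w\mapsto\lfloor w\rfloor$. Let $\mathfrak{S}^\star(X)$ be the set of words on $X\sqcup\{\star\}$ with exactly one occurrence of $\star$; for $q\in\mathfrak{S}^\star(X)$ and a word $u$, $q|_u$ is $q$ with $\star$ replaced by $u$, and $q|_s=\sum_i c_i\,q|_{u_i}$ for $s=\sum_i c_iu_i$. For $S\subseteq\mathbf{k}\mathfrak{S}(X)$, $\mathrm{Id}(S)$ is the operated ideal (two-sided ideal closed under $P$) generated by $S$. **Order.** Order $X\sqcup\{P,\mu\}$ by the order of $X$ and $x<P<\mu$ for $x\in X$. The path in $w$ of an occurrence of a letter is a word on this alphabet: the path of $x$ in $w=x$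 is $x$; a path in $\lfloor u\rfloor$ is $P$ followed by the path in $u$; a path in $w_1\cdots w_n$ ($w_i$ prime, $n\ge2$) is $\mu$ followed by the path in the factor $w_i$ containing the occurrence. Let $\deg w$ be the number of occurrences of letters in $w$ and $\mathrm{path}_r(w)$ the tuple of the paths of all these occurrences, listed from right to left. Define $u\le_{\mathrm{PL}_r}v$ iff $(\deg u,\mathrm{path}_r(u))\le(\deg v,\mathrm{path}_r(v))$ lexicographically, single paths being compared by the degree lexicographical order. Write $u<v$ if $u\le_{\mathrm{PL}_r}v$ and not $v\le_{\mathrm{PL}_r}u$. **Gröbner–Shirshov bases.** The leading monomial $\bar s$ of $s\in\mathbf{k}\mathfrak{S}(X)$ is the monomial occurring in $s$ that is strictly larger than all others occurring in $s$ (if there is one); $s$ is monic if $\bar s$ exists and has coefficient $1$. An element $f$ is trivial modulo $(S,w)$ if $f=\sum_i c_i\,q_i|_{s_i}$ (a finite sum) with $c_i\in\mathbf{k}$, $q_i\in\mathfrak{S}^\star(X)$, $s_i\in S$, where each $q_i|_{s_i}$ has a leading monomial and $\overline{q_i|_{s_i}}<w$. $S$ is a Gröbner–Shirshov basis if all its elements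 are monic and, for all $f,g\in S$: (i) $fu-vg$ is trivial modulo $(S,w)$ whenever $w=\bar fu=v\bar g$ with $u,v\in\mathfrak{S}(X)$ and $\max\{|\bar f|,|\bar g|\}<|w|<|\bar f|+|\bar g|$; (ii) $f-q|_g$ is trivial modulo $(S,w)$ whenever $w=\bar f=q|_{\bar g}$ with $q\in\mathfrak{S}^\star(X)$. **Modified Rota–Baxter algebras.** A nonunitary modified Rota–Baxter algebra of weight $\lambda$ is a nonunitary associative $\mathbf{k}$-algebra $A$ with a linear operator $P$ satisfying $P(x)P(y)=P(P(x)y+xP(y))+\lambda xy$ for all $x,y\in A$. **Theorem.** Let $S=\{f(x,y)\mid x,y\in\mathfrak{S}(X)\}$ with $f(x,y)=\lfloor x\lfloor y\rfloor\rfloor+\lfloor\lfloor x\rfloor y\rfloor+\lambda xy-\lfloor x\rfloor\lfloor y\rfloor$. 1. The relation $\le_{\mathrm{PL}_r}$ is a total preorder on $\mathfrak{S}(X)$ whose strict part $<$ is well-founded. For all $x,y\in\mathfrak{S}(X)$ and $q\in\mathfrak{S}^\star(X)$ we have $\overline{f(x,y)}=\lfloor x\lfloor y\rfloor\rfloor$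 and $\overline{q|_{f(x,y)}}=q|_{\lfloor x\lfloor y\rfloor\rfloor}$. The set $S$ is a Gröbner–Shirshov basis in $\mathbf{k}\mathfrak{S}(X)$ with respect to $\le_{\mathrm{PL}_r}$. 2. $\mathbf{k}\mathfrak{S}(X)/\mathrm{Id}(S)$, with the operator induced by $P$ and the map $X\to\mathbf{k}\mathfrak{S}(X)/\mathrm{Id}(S)$ sending a letter to its class, is the free nonunitary modified Rota–Baxter algebra of weight $\lambda$ on $X$: every map from $X$ to a nonunitary modified Rota–Baxter algebra of weight $\lambda$ extends uniquely to an algebra homomorphism commuting with the operators. The classes of the words in $$\mathrm{Irr}(S)=\mathfrak{S}(X)\setminus\{\,q|_{\lfloor x\lfloor y\rfloor\rfloor}\mid x,y\in\mathfrak{S}(X),\ q\in\mathfrak{S}^\star(X)\,\}$$ (pairwise distinct for distinct words) form a $\mathbf{k}$-basis of it. -/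

import Mathlib

universe u v w

/-- The bracketed words on `X` that do not involve the empty word, i.e. the elements of the free
operated semigroup `𝔖(X)`. Such a word is a nonempty sequence of primes, a prime being a letter
`x` or a bracket `⌊u⌋` with `u` in `𝔖(X)`. The four constructors are the words `x`, `⌊u⌋`, `x w`
and `⌊u⌋ w` (a word of breadth at least two being split after its first prime), so that every
word is written in exactly one way. -/
inductive BWord (X : Type u) : Type u
  | letter (x : X) : BWord X
  | bracket (u : BWord X) : BWord X
  | letterMul (x : X) (w : BWord X) : BWord X
  | bracketMul (u w : BWord X) : BWord X

namespace BWord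

variable {X : Type u}

/-- Concatenation of bracketed words. -/
protected def mul : BWord X → BWord X → BWord X
  | letter x, v => letterMul x v
  | bracket u, v => bracketMul u v
  | letterMul x w, v => letterMul x (BWord.mul w v)
  | bracketMul u w, v => bracketMul u (BWord.mul w v)

instance : Mul (BWord X) := ⟨BWord.mul⟩

theorem mul_assoc' (a b c : BWord X) : a * b * c = a * (b * c) := by
  change BWord.mul (BWord.mul a b) c = BWord.mul a (BWord.mul b c)
  induction a with
  | letter x => rfl
  | bracket u _ => rfl
  | letterMul x w ih => simp only [BWord.mul, ih]
  | bracketMul u w _ ih => simp only [BWord.mul, ih]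

instance : Semigroup (BWord X) where
  mul_assoc := mul_assoc'

/-- The breadth `|w|`: the number of prime factors of `w`. -/
def breadth : BWord X → ℕ
  | letter _ => 1
  | bracket _ => 1
  | letterMul _ w => 1 + breadth w
  | bracketMul _ w => 1 + breadth w

/-- The total number of occurrences of letters in a word. -/
def deg : BWord X → ℕ
  | letter _ => 1
  | bracket u => deg u
  | letterMul _ w => 1 + deg w
  | bracketMul u w => deg u + deg w

/-- The number of occurrences of `⋆` (which is `none`) in a word on `X ⊔ {⋆}`. -/
def starCount : BWord (Option X) → ℕ
  | letter none => 1
  | letter (some _) => 0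
  | bracket u => starCount u
  | letterMul none w => 1 + starCount w
  | letterMul (some _) w => starCount w
  | bracketMul u w => starCount u + starCount w

/-- Replace every `⋆` in a word on `X ⊔ {⋆}` by the word `u`. -/
def subst (u : BWord X) : BWord (Option X) → BWord X
  | letter none => u
  | letter (some x) => letter x
  | bracket v => bracket (subst u v)
  | letterMul none w => u * subst u w
  | letterMul (some x) w => letterMul x (subst u w)
  | bracketMul v w => bracketMul (subst u v) (subst u w)

/-- The alphabet `X ⊔ {P, μ}`, ordered by the order of `X` and `x < P < μ` for all `x` in `X`. -/
abbrev PathSym (X : Type u) : Type u := WithTop (WithTop X)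

/-- A letter of `X` as a symbol in a path. -/
def symLetter (x : X) : PathSym X := ((x : WithTop X) : WithTop (WithTop X))

/-- The symbol `P`, for the bracket. -/
def symP : PathSym X := ((⊤ : WithTop X) : WithTop (WithTop X))

/-- The symbol `μ`, for the multiplication. -/
def symMu : PathSym X := ⊤

/-- Put the symbol `μ` in front of all paths in `l`, provided that the word `w` has breadth at
least two. -/
def addMu (w : BWord X) (l : List (List (PathSym X))) : List (List (PathSym X)) :=
  if 2 ≤ w.breadth then l.map (fun p => symMu :: p) else l

/-- For `w = w₁ ⋯ wₙ` with primes `wⱼ`, the list, over all occurrences of letters in `w` from left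
to right, of the path of that occurrence in the prime factor `wⱼ` that contains it. -/
def factorPaths : BWord X → List (List (PathSym X))
  | letter x => [[symLetter x]]
  | bracket u => (addMu u (factorPaths u)).map (fun p => symP :: p)
  | letterMul x w => [symLetter x] :: factorPaths w
  | bracketMul u w => (addMu u (factorPaths u)).map (fun p => symP :: p) ++ factorPaths w

/-- The paths of all occurrences of letters in `w`, from left to right: the path in `x` of the
letter `x` is `x`, a path in `⌊u⌋` is `P` followed by the path in `u`, and a path in `w₁ ⋯ wₙ`
with `n ≥ 2` primes `wⱼ` is `μ` followed by the path in `wⱼ`. -/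
def pathL (w : BWord X) : List (List (PathSym X)) := addMu w (factorPaths w)

/-- The paths of all occurrences of letters in `w`, from right to left. -/
def pathR (w : BWord X) : List (List (PathSym X)) := (pathL w).reverse

/-- The relation `u ≤ v` that compares `(deg u, pathR u)` and `(deg v, pathR v)`
lexicographically, where single paths are compared by the degree lexicographical order
(`List.Shortlex`). -/
def lePLr [LinearOrder X] (u v : BWord X) : Prop :=
  Prod.Lex (fun a b : ℕ => a < b) (List.Lex (List.Shortlex (fun a b : PathSym X => a < b)))
    (deg u, pathR u) (deg v, pathR v) ∨ (deg u, pathR u) = (deg v, pathR v)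

end BWord

/-- The `⋆`-bracketed words `𝔖^⋆(X)`: the words on `X ⊔ {⋆}` with exactly one occurrence
of `⋆`. -/
def StarWord (X : Type u) : Type u := {q : BWord (Option X) // q.starCount = 1}

/-- `q|_u`, the word obtained by replacing `⋆` in `q` by `u`. -/
def StarWord.app {X : Type u} (q : StarWord X) (u : BWord X) : BWord X := BWord.subst u q.1

/-- The free module `k𝔖(X)` on the bracketed words with its bilinear multiplication. -/
abbrev WordAlg (k : Type v) [CommRing k] (X : Type u) := MonoidAlgebra k (BWord X)

noncomputable section

namespace WordAlg

variable {k : Type v} [CommRing k] {X : Type u}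

/-- A word as an element of `k𝔖(X)`. -/
def word (k : Type v) [CommRing k] (w : BWord X) : WordAlg k X := MonoidAlgebra.single w 1

/-- The linear operator on `k𝔖(X)` that extends `w ↦ ⌊w⌋`. -/
def op (k : Type v) [CommRing k] (X : Type u) : WordAlg k X →ₗ[k] WordAlg k X :=
  MonoidAlgebra.mapDomainLinearMap k k BWord.bracket

/-- `q|_s = ∑ cᵢ q|_{uᵢ}` for `s = ∑ cᵢ uᵢ`. -/
def app (q : StarWord X) (s : WordAlg k X) : WordAlg k X := MonoidAlgebra.mapDomain q.app s

end WordAlg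

/-- The strict part of a relation `≤`. -/
def StrictPart {α : Type u} (le : α → α → Prop) (a b : α) : Prop := le a b ∧ ¬ le b a

section GroebnerShirshov

variable {k : Type v} [CommRing k] {X : Type u} (le : BWord X → BWord X → Prop)

/-- `m` is the leading monomial of `s`: it occurs in `s`, and every other monomial occurring
in `s` is strictly smaller. -/
def IsLeadingMonomial (s : WordAlg k X) (m : BWord X) : Prop :=
  m ∈ s.coeff.support ∧ ∀ m' ∈ s.coeff.support, m' ≠ m → StrictPart le m' m

/-- `s` has a leading monomial, and its coefficient is `1`. -/
def IsMonic (s : WordAlg k X) : Prop :=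
  ∃ m, IsLeadingMonomial le s m ∧ s.coeff m = 1

/-- `f` is trivial modulo `(S, w)`: it is a linear combination of elements `q|_s` with `s ∈ S`
whose leading monomial is strictly smaller than `w`. -/
def IsTrivialMod (S : Set (WordAlg k X)) (w : BWord X) (f : WordAlg k X) : Prop :=
  f ∈ Submodule.span k {g : WordAlg k X | ∃ (q : StarWord X) (s : WordAlg k X) (m : BWord X),
    s ∈ S ∧ g = WordAlg.app q s ∧ IsLeadingMonomial le g m ∧ StrictPart le m w}

/-- `S` is a Gröbner–Shirshov basis in `k𝔖(X)`: it is monic, and all intersection compositions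
and all including compositions of elements of `S` are trivial. -/
structure IsGroebnerShirshovBasis (S : Set (WordAlg k X)) : Prop where
  monic : ∀ s ∈ S, IsMonic le s
  intersection : ∀ f ∈ S, ∀ g ∈ S, ∀ a b w u v : BWord X,
    IsLeadingMonomial le f a → IsLeadingMonomial le g b → w = a * u → w = v * b →
    max a.breadth b.breadth < w.breadth → w.breadth < a.breadth + b.breadth →
    IsTrivialMod le S w (f * WordAlg.word k u - WordAlg.word k v * g)
  including : ∀ f ∈ S, ∀ g ∈ S, ∀ (a b : BWord X) (q : StarWord X),
    IsLeadingMonomial le f a → IsLeadingMonomial le g b → a = q.app b →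
    IsTrivialMod le S a (f - WordAlg.app q g)

end GroebnerShirshov

section OperatedAlgebra

variable {k : Type v} [CommRing k] {A : Type w} [NonUnitalRing A] [Module k A]

/-- The submodule `I` is an operated ideal of the nonunitary algebra `A` with operator `P`. -/
def IsOperatedIdeal (P : A →ₗ[k] A) (I : Submodule k A) : Prop :=
  (∀ a : A, ∀ b ∈ I, a * b ∈ I) ∧ (∀ a : A, ∀ b ∈ I, b * a ∈ I) ∧ ∀ b ∈ I, P b ∈ I

/-- `Id(S)`, the operated ideal generated by `S`. -/
def operatedIdeal (P : A →ₗ[k] A) (S : Set A) : Submodule k A :=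
  sInf {I | IsOperatedIdeal P I ∧ S ⊆ I}

theorem isOperatedIdeal_operatedIdeal (P : A →ₗ[k] A) (S : Set A) :
    IsOperatedIdeal P (operatedIdeal P S) := by
  simp only [operatedIdeal, IsOperatedIdeal, Submodule.mem_sInf]
  exact ⟨fun a b hb I hI => hI.1.1 a b (hb I hI), fun a b hb I hI => hI.1.2.1 a b (hb I hI),
    fun b hb I hI => hI.1.2.2 b (hb I hI)⟩

/-- The quotient `A / Id(S)`. -/
def OperatedQuotient (P : A →ₗ[k] A) (S : Set A) : Type w := A ⧸ operatedIdeal P S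

namespace OperatedQuotient

variable (P : A →ₗ[k] A) (S : Set A)

instance : AddCommGroup (OperatedQuotient P S) :=
  inferInstanceAs (AddCommGroup (A ⧸ operatedIdeal P S))

instance : Module k (OperatedQuotient P S) :=
  inferInstanceAs (Module k (A ⧸ operatedIdeal P S))

/-- The canonical map `η : A → A / Id(S)`. -/
def mk : A →ₗ[k] OperatedQuotient P S := (operatedIdeal P S).mkQ

theorem mk_surjective : Function.Surjective (mk P S) := (operatedIdeal P S).mkQ_surjective

/-- The multiplication of `A / Id(S)` induced by that of `A`. -/
instance : Mul (OperatedQuotient P S) where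
  mul := Quotient.map₂ (fun a b => a * b) (by
    intro a a' ha b b' hb
    have ha' : a - a' ∈ operatedIdeal P S := (Submodule.quotientRel_def _).1 ha
    have hb' : b - b' ∈ operatedIdeal P S := (Submodule.quotientRel_def _).1 hb
    refine (Submodule.quotientRel_def _).2 ?_
    have h : a * b - a' * b' = (a - a') * b + a' * (b - b') := by
      rw [sub_mul, mul_sub]; abel
    rw [h]
    exact add_mem ((isOperatedIdeal_operatedIdeal P S).2.1 _ _ ha')
      ((isOperatedIdeal_operatedIdeal P S).1 _ _ hb'))

theorem mk_mul (a b : A) : mk P S (a * b) = mk P S a * mk P S b := rfl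

instance : NonUnitalRing (OperatedQuotient P S) where
  left_distrib x y z := by
    obtain ⟨a, rfl⟩ := mk_surjective P S x
    obtain ⟨b, rfl⟩ := mk_surjective P S y
    obtain ⟨c, rfl⟩ := mk_surjective P S z
    simp only [← mk_mul, ← map_add, mul_add]
  right_distrib x y z := by
    obtain ⟨a, rfl⟩ := mk_surjective P S x
    obtain ⟨b, rfl⟩ := mk_surjective P S y
    obtain ⟨c, rfl⟩ := mk_surjective P S z
    simp only [← mk_mul, ← map_add, add_mul]
  zero_mul x := by
    obtain ⟨a, rfl⟩ := mk_surjective P S x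
    rw [← map_zero (mk P S), ← mk_mul, zero_mul]
  mul_zero x := by
    obtain ⟨a, rfl⟩ := mk_surjective P S x
    rw [← map_zero (mk P S), ← mk_mul, mul_zero]
  mul_assoc x y z := by
    obtain ⟨a, rfl⟩ := mk_surjective P S x
    obtain ⟨b, rfl⟩ := mk_surjective P S y
    obtain ⟨c, rfl⟩ := mk_surjective P S z
    simp only [← mk_mul, mul_assoc]

/-- The operator of `A / Id(S)` induced by `P`. -/
def op : OperatedQuotient P S →ₗ[k] OperatedQuotient P S :=
  (operatedIdeal P S).mapQ (operatedIdeal P S) P (isOperatedIdeal_operatedIdeal P S).2.2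

theorem op_mk (a : A) : op P S (mk P S a) = mk P S (P a) := rfl

instance [IsScalarTower k A A] : IsScalarTower k (OperatedQuotient P S) (OperatedQuotient P S) where
  smul_assoc c x y := by
    obtain ⟨a, rfl⟩ := mk_surjective P S x
    obtain ⟨b, rfl⟩ := mk_surjective P S y
    simp only [smul_eq_mul, ← map_smul, ← mk_mul, smul_mul_assoc]

instance [SMulCommClass k A A] : SMulCommClass k (OperatedQuotient P S) (OperatedQuotient P S) where
  smul_comm c x y := by
    obtain ⟨a, rfl⟩ := mk_surjective P S x
    obtain ⟨b, rfl⟩ := mk_surjective P S y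
    simp only [smul_eq_mul, ← map_smul, ← mk_mul, mul_smul_comm]

end OperatedQuotient

/-- `P` is a modified Rota–Baxter operator of weight `lam` on the nonunitary algebra `A`. -/
def IsModifiedRotaBaxter (lam : k) (P : A →ₗ[k] A) : Prop :=
  ∀ x y : A, P x * P y = P (P x * y + x * P y) + lam • (x * y)

end OperatedAlgebra

/-- The nonunitary algebra `F` with the operator `P` and the map `i : X → F` is the free nonunitary
modified Rota–Baxter algebra of weight `lam` on `X`: every map from `X` to a nonunitary modified
Rota–Baxter algebra `A` of weight `lam` extends uniquely to a homomorphism that commutes with the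
operators. -/
def IsFreeModifiedRotaBaxter.{a, b, c, d} {k : Type a} [CommRing k] {X : Type b} {F : Type c}
    [NonUnitalRing F] [Module k F] (lam : k) (P : F →ₗ[k] F) (i : X → F) : Prop :=
  IsModifiedRotaBaxter lam P ∧
  ∀ (A : Type d) [NonUnitalRing A] [Module k A] [IsScalarTower k A A] [SMulCommClass k A A]
    (Q : A →ₗ[k] A), IsModifiedRotaBaxter lam Q → ∀ φ : X → A,
    ∃! h : F →ₙₐ[k] A, (∀ x : F, h (P x) = Q (h x)) ∧ ∀ x : X, h (i x) = φ x

section ModifiedRotaBaxter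

variable {k : Type v} [CommRing k] {X : Type u}

/-- The word `⌊x⌊y⌋⌋`. -/
def leadWord (x y : BWord X) : BWord X := (x * y.bracket).bracket

/-- `⌊x⌊y⌋⌋ + ⌊⌊x⌋y⌋ + λ xy - ⌊x⌋⌊y⌋`. -/
def mrbElem (lam : k) (x y : BWord X) : WordAlg k X :=
  WordAlg.word k (leadWord x y) + WordAlg.word k (x.bracket * y).bracket
    + lam • WordAlg.word k (x * y) - WordAlg.word k (x.bracket * y.bracket)

/-- The set of all `⌊x⌊y⌋⌋ + ⌊⌊x⌋y⌋ + λ xy - ⌊x⌋⌊y⌋` with `x, y ∈ 𝔖(X)`. -/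
def Smrbr (lam : k) (X : Type u) : Set (WordAlg k X) :=
  {s | ∃ x y : BWord X, s = mrbElem lam x y}

/-- The words in `𝔖(X)` that are not of the form `q|_{⌊x⌊y⌋⌋}`. -/
def IrrSmrbr (X : Type u) : Set (BWord X) :=
  {w | ¬ ∃ (q : StarWord X) (x y : BWord X), w = q.app (leadWord x y)}

/-- The quotient `k𝔖(X) / Id(S)`. -/
abbrev MRBQuotient (lam : k) (X : Type u) : Type (max u v) :=
  OperatedQuotient (WordAlg.op k X) (Smrbr lam X)

end ModifiedRotaBaxter

end

/-! Leading monomials. In `⌊x⌊y⌋⌋` the rightmost letter of `y` lies under two brackets and one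
product that are not part of `y`, so its path is longer than in `⌊⌊x⌋y⌋`, `xy` or `⌊x⌋⌊y⌋`; the
degrees agree. `PathLt` is a form of this comparison that survives brackets and products, hence
every context (`StarWord.pathLt_app`).

Gröbner–Shirshov property. Instead of resolving compositions one by one, a model is built. The
relation `⌊x⌊y⌋⌋ = ⌊x⌋⌊y⌋ - λxy - ⌊⌊x⌋y⌋`, read as a recursion, defines a linear operator `irrOp`
that preserves the span of the irreducible words and satisfies the modified Rota–Baxter identity
there (`word_mem_rotaBaxterRight`). The universal property of the free operated algebra then gives a
homomorphism `normalForm` that kills `Id(S)` and fixes the irreducible words, so `Id(S)` meets their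
span only in `0` (`eq_zero_of_mem_operatedIdeal`).

In a composition at `w` the top terms cancel. Reducing the rest uses only elements `q|_s` with
leading monomial below `w` (`word_mem_supported_sup`) and leaves an irreducible remainder lying in
`Id(S)`, which is therefore `0`. The same two facts, reduction and trivial intersection, give the
basis of the quotient. Its freeness comes directly from the evaluation of words. -/

namespace BWord

variable {X : Type u}

/-! ### Breadth, degree and paths of products -/

theorem letter_mul (x : X) (w : BWord X) : letter x * w = letterMul x w := rfl

theorem bracket_mul (u w : BWord X) : bracket u * w = bracketMul u w := rfl

theorem letterMul_mul (x : X) (w v : BWord X) : letterMul x w * v = letterMul x (w * v) := rfl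

theorem bracketMul_mul (u w v : BWord X) : bracketMul u w * v = bracketMul u (w * v) := rfl

theorem breadth_pos (w : BWord X) : 1 ≤ w.breadth := by
  cases w <;> simp [breadth]

theorem breadth_mul (a b : BWord X) : (a * b).breadth = a.breadth + b.breadth := by
  induction a with
  | letter x => rfl
  | bracket u _ => rfl
  | letterMul x w ih => rw [letterMul_mul, breadth, breadth, ih, add_assoc]
  | bracketMul u w _ ih => rw [bracketMul_mul, breadth, breadth, ih, add_assoc]

theorem deg_pos (w : BWord X) : 1 ≤ w.deg := by
  induction w with
  | letter x => simp [deg]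
  | bracket u ih => simpa [deg] using ih
  | letterMul x w ih => simp [deg]
  | bracketMul u w ih _ => simp only [deg]; omega

theorem deg_mul (a b : BWord X) : (a * b).deg = a.deg + b.deg := by
  induction a with
  | letter x => rfl
  | bracket u _ => rfl
  | letterMul x w ih => rw [letterMul_mul, deg, deg, ih, add_assoc]
  | bracketMul u w _ ih => rw [bracketMul_mul, deg, deg, ih, add_assoc]

theorem factorPaths_mul (a b : BWord X) :
    (a * b).factorPaths = a.factorPaths ++ b.factorPaths := by
  induction a with
  | letter x => rfl
  | bracket u _ => rfl
  | letterMul x w ih => rw [letterMul_mul, factorPaths, factorPaths, ih, List.cons_append]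
  | bracketMul u w _ ih => rw [bracketMul_mul, factorPaths, factorPaths, ih, List.append_assoc]

theorem factorPaths_bracket (u : BWord X) :
    u.bracket.factorPaths = u.pathL.map (fun p => symP :: p) := rfl

theorem pathL_bracket (u : BWord X) : u.bracket.pathL = u.pathL.map (fun p => symP :: p) := rfl

theorem pathL_mul (a b : BWord X) :
    (a * b).pathL = (a.factorPaths ++ b.factorPaths).map (fun p => symMu :: p) := by
  have h : 2 ≤ (a * b).breadth := by
    have := breadth_pos a
    have := breadth_pos b
    rw [breadth_mul]; omega
  rw [pathL, addMu, if_pos h, factorPaths_mul]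

theorem length_addMu (w : BWord X) (l : List (List (PathSym X))) :
    (addMu w l).length = l.length := by
  unfold addMu; split <;> simp

theorem length_factorPaths (w : BWord X) : w.factorPaths.length = w.deg := by
  induction w with
  | letter x => rfl
  | bracket u ih => simp [factorPaths, deg, length_addMu, ih]
  | letterMul x w ih => simp [factorPaths, deg, ih, add_comm]
  | bracketMul u w ih ih' => simp [factorPaths, deg, length_addMu, ih, ih']

theorem length_pathR (w : BWord X) : w.pathR.length = w.deg := by
  rw [pathR, List.length_reverse, pathL, length_addMu, length_factorPaths]

/-! ### The preorder and its well-foundedness -/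

section Order

variable [LinearOrder X]

/-- The strict order on lists of paths that underlies `lePLr`. -/
abbrev pathListLt : List (List (PathSym X)) → List (List (PathSym X)) → Prop :=
  List.Shortlex (List.Shortlex (fun a b : PathSym X => a < b))

/-- The degree is the length of the list of paths, so comparing degrees first turns the
lexicographic order on lists into the shortlex order, whose well-foundedness is inherited from the
alphabet. -/
theorem lePLr_iff (a b : BWord X) :
    lePLr a b ↔ pathListLt a.pathR b.pathR ∨ a.pathR = b.pathR := by
  rw [lePLr, pathListLt, List.shortlex_def, Prod.lex_def, length_pathR, length_pathR, Prod.mk.injEq]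
  refine or_congr Iff.rfl ⟨fun h => h.2, fun h => ⟨?_, h⟩⟩
  rw [← length_pathR a, h, length_pathR]

theorem lePLr_total (a b : BWord X) : lePLr a b ∨ lePLr b a := by
  rw [lePLr_iff, lePLr_iff]
  rcases trichotomous_of pathListLt a.pathR b.pathR with h | h | h
  · exact Or.inl (Or.inl h)
  · exact Or.inl (Or.inr h)
  · exact Or.inr (Or.inl h)

variable [WellFoundedLT X]

theorem wellFounded_pathListLt : WellFounded (pathListLt (X := X)) :=
  List.Shortlex.wf (List.Shortlex.wf wellFounded_lt)

theorem pathListLt_trans {a b c : List (List (PathSym X))} (h : pathListLt a b)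
    (h' : pathListLt b c) : pathListLt a c := by
  have wf := wellFounded_pathListLt (X := X)
  rcases trichotomous_of pathListLt a c with hac | rfl | hca
  · exact hac
  · exact absurd h' (wf.asymmetric _ _ h)
  · exact absurd hca (wf.asymmetric₃ _ _ _ h h')

/-- Distinct words may have the same paths, so only a preorder is available on words; the strict
part is the pullback of a strict order along `pathR`. -/
theorem strictPart_lePLr_iff (a b : BWord X) :
    StrictPart lePLr a b ↔ pathListLt a.pathR b.pathR := by
  have wf := wellFounded_pathListLt (X := X)
  rw [StrictPart, lePLr_iff, lePLr_iff]
  constructor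
  · rintro ⟨h | h, h'⟩
    · exact h
    · exact absurd (Or.inr h.symm) h'
  · refine fun h => ⟨Or.inl h, ?_⟩
    rintro (h' | h')
    · exact wf.asymmetric _ _ h h'
    · rw [h'] at h; exact wf.irrefl.irrefl _ h

theorem lePLr_trans (a b c : BWord X) (h : lePLr a b) (h' : lePLr b c) : lePLr a c := by
  rw [lePLr_iff] at *
  rcases h with h | h
  · rcases h' with h' | h'
    · exact Or.inl (pathListLt_trans h h')
    · exact Or.inl (h' ▸ h)
  · rwa [h]

theorem strictPart_trans {a b c : BWord X} (h : StrictPart lePLr a b)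
    (h' : StrictPart lePLr b c) : StrictPart lePLr a c := by
  rw [strictPart_lePLr_iff] at *
  exact pathListLt_trans h h'

theorem wellFounded_strictPart : WellFounded (StrictPart (lePLr (X := X))) :=
  Subrelation.wf (fun h => (strictPart_lePLr_iff _ _).1 h)
    (InvImage.wf pathR (wellFounded_pathListLt (X := X)))

end Order

/-! ### A comparison of words that is stable under contexts -/

/-- From right to left, the first difference between `l` and `l'` is a path that is shorter
in `l`. -/
def ShorterPath (l l' : List (List (PathSym X))) : Prop :=
  ∃ t t' p p' s, l = t ++ p :: s ∧ l' = t' ++ p' :: s ∧ p.length < p'.length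

namespace ShorterPath

variable {l l' : List (List (PathSym X))}

theorem append_left (h : ShorterPath l l') (a : List (List (PathSym X))) :
    ShorterPath (a ++ l) (a ++ l') := by
  obtain ⟨t, t', p, p', s, rfl, rfl, h⟩ := h
  exact ⟨a ++ t, a ++ t', p, p', s, by simp, by simp, h⟩

theorem append_right (h : ShorterPath l l') (a : List (List (PathSym X))) :
    ShorterPath (l ++ a) (l' ++ a) := by
  obtain ⟨t, t', p, p', s, rfl, rfl, h⟩ := h
  exact ⟨t, t', p, p', s ++ a, by simp, by simp, h⟩

theorem map_cons (h : ShorterPath l l') (c : PathSym X) :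
    ShorterPath (l.map (fun p => c :: p)) (l'.map (fun p => c :: p)) := by
  obtain ⟨t, t', p, p', s, rfl, rfl, h⟩ := h
  exact ⟨t.map (fun p => c :: p), t'.map (fun p => c :: p), c :: p, c :: p',
    s.map (fun p => c :: p), by simp, by simp, by simpa using h⟩

end ShorterPath

/-- A sufficient condition, stable under all contexts, for `u` to be smaller than `v`. -/
structure PathLt (u v : BWord X) : Prop where
  deg_eq : u.deg = v.deg
  -- Both lists are needed: a bracket sees `pathL`, while a product sees `factorPaths`, and the two
  -- differ by a `μ` that depends on the breadth.
  shorter_factorPaths : ShorterPath u.factorPaths v.factorPaths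
  shorter_pathL : ShorterPath u.pathL v.pathL

namespace PathLt

variable {u v : BWord X}

theorem bracket (h : PathLt u v) : PathLt u.bracket v.bracket :=
  ⟨h.deg_eq, h.shorter_pathL.map_cons _, h.shorter_pathL.map_cons _⟩

theorem mul_left (h : PathLt u v) (a : BWord X) : PathLt (a * u) (a * v) where
  deg_eq := by rw [deg_mul, deg_mul, h.deg_eq]
  shorter_factorPaths := by
    rw [factorPaths_mul, factorPaths_mul]; exact h.shorter_factorPaths.append_left _
  shorter_pathL := by
    rw [pathL_mul, pathL_mul]; exact (h.shorter_factorPaths.append_left _).map_cons _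

theorem mul_right (h : PathLt u v) (a : BWord X) : PathLt (u * a) (v * a) where
  deg_eq := by rw [deg_mul, deg_mul, h.deg_eq]
  shorter_factorPaths := by
    rw [factorPaths_mul, factorPaths_mul]; exact h.shorter_factorPaths.append_right _
  shorter_pathL := by
    rw [pathL_mul, pathL_mul]; exact (h.shorter_factorPaths.append_right _).map_cons _

theorem ne (h : PathLt u v) : u ≠ v := by
  rintro rfl
  obtain ⟨t, t', p, p', s, h₁, h₂, hp⟩ := h.shorter_pathL
  have h3 : t.length = t'.length := by
    have := congrArg List.length (h₁.symm.trans h₂)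
    simpa using this
  have := List.append_inj_right (h₁.symm.trans h₂) h3
  simp only [List.cons.injEq, and_true] at this
  rw [this] at hp
  exact lt_irrefl _ hp

theorem strictPart [LinearOrder X] [WellFoundedLT X] (h : PathLt u v) :
    StrictPart lePLr u v := by
  rw [strictPart_lePLr_iff]
  refine List.Shortlex.of_lex (by rw [length_pathR, length_pathR, h.deg_eq]) ?_
  obtain ⟨t, t', p, p', s, h₁, h₂, hp⟩ := h.shorter_pathL
  rw [pathR, pathR, h₁, h₂]
  simp only [List.reverse_append, List.reverse_cons, List.append_assoc]
  exact List.Lex.append_left _ (.rel (.of_length_lt hp)) _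

end PathLt

/-! ### The rightmost path decides the leading monomial -/

/-- The last path in `l` has length `n`. -/
def LastLength (l : List (List (PathSym X))) (n : ℕ) : Prop := ∃ t p, l = t ++ [p] ∧ p.length = n

namespace LastLength

variable {l l' : List (List (PathSym X))} {n n' : ℕ}

theorem append_left (h : LastLength l n) (a : List (List (PathSym X))) :
    LastLength (a ++ l) n := by
  obtain ⟨t, p, rfl, h⟩ := h
  exact ⟨a ++ t, p, by simp, h⟩

theorem map_cons (h : LastLength l n) (c : PathSym X) :
    LastLength (l.map (fun p => c :: p)) (n + 1) := by
  obtain ⟨t, p, rfl, rfl⟩ := h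
  exact ⟨t.map (fun p => c :: p), c :: p, by simp, by simp⟩

theorem shorterPath (h : LastLength l n) (h' : LastLength l' n') (hn : n < n') :
    ShorterPath l l' := by
  obtain ⟨t, p, rfl, rfl⟩ := h
  obtain ⟨t', p', rfl, rfl⟩ := h'
  exact ⟨t, t', p, p', [], rfl, rfl, hn⟩

end LastLength

/-- The two lengths differ by the possible leading `μ`. -/
theorem exists_lastLength (y : BWord X) :
    ∃ m n, LastLength y.factorPaths m ∧ LastLength y.pathL n ∧ m ≤ n := by
  have h : y.factorPaths ≠ [] := by
    rw [← List.length_pos_iff, length_factorPaths]; exact deg_pos y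
  have h' : LastLength y.factorPaths _ := ⟨_, _, (List.dropLast_append_getLast h).symm, rfl⟩
  by_cases hb : 2 ≤ y.breadth
  · exact ⟨_, _, h', by rw [pathL, addMu, if_pos hb]; exact h'.map_cons _, Nat.le_succ _⟩
  · exact ⟨_, _, h', by rw [pathL, addMu, if_neg hb]; exact h', le_rfl⟩

/-- The three extra symbols are `P`, `μ`, `P`, from the outer bracket, the product and the inner
bracket. Each competing monomial adds at most two. -/
theorem lastLength_pathL_leadWord {x y : BWord X} {n : ℕ} (h : LastLength y.pathL n) :
    LastLength (leadWord x y).pathL (n + 3) := by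
  rw [leadWord, pathL_bracket, pathL_mul, factorPaths_bracket]
  exact (((h.map_cons _).append_left _).map_cons _).map_cons _

theorem pathLt_leadWord_of_lastLength {u x y : BWord X} {l m n : ℕ} (hd : u.deg = x.deg + y.deg)
    (hl : LastLength u.factorPaths l) (hm : LastLength u.pathL m) (h : LastLength y.pathL n)
    (hln : l < n + 3) (hmn : m < n + 3) : PathLt u (leadWord x y) :=
  ⟨by rw [hd, leadWord, deg, deg_mul, deg],
    hl.shorterPath (lastLength_pathL_leadWord h) hln,
    hm.shorterPath (lastLength_pathL_leadWord h) hmn⟩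

theorem pathLt_bracket_mul_leadWord (x y : BWord X) :
    PathLt (x.bracket * y).bracket (leadWord x y) := by
  obtain ⟨m, n, h, h', hmn⟩ := exists_lastLength y
  have hl : LastLength (x.bracket * y).bracket.pathL (m + 2) := by
    rw [pathL_bracket, pathL_mul]
    exact ((h.append_left _).map_cons _).map_cons _
  exact pathLt_leadWord_of_lastLength (by simp [deg, deg_mul]) hl hl h' (by omega) (by omega)

theorem pathLt_mul_leadWord (x y : BWord X) : PathLt (x * y) (leadWord x y) := by
  obtain ⟨m, n, h, h', hmn⟩ := exists_lastLength y
  have hl : LastLength (x * y).pathL (m + 1) := by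
    rw [pathL_mul]
    exact (h.append_left _).map_cons _
  have hf : LastLength (x * y).factorPaths m := by
    rw [factorPaths_mul]
    exact h.append_left _
  exact pathLt_leadWord_of_lastLength (deg_mul x y) hf hl h' (by omega) (by omega)

theorem pathLt_bracket_mul_bracket_leadWord (x y : BWord X) :
    PathLt (x.bracket * y.bracket) (leadWord x y) := by
  obtain ⟨m, n, h, h', hmn⟩ := exists_lastLength y
  have hl : LastLength (x.bracket * y.bracket).pathL (n + 2) := by
    rw [pathL_mul, factorPaths_bracket y]
    exact ((h'.map_cons _).append_left _).map_cons _
  have hf : LastLength (x.bracket * y.bracket).factorPaths (n + 1) := by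
    rw [factorPaths_mul, factorPaths_bracket y]
    exact (h'.map_cons _).append_left _
  exact pathLt_leadWord_of_lastLength (by simp [deg, deg_mul]) hf hl h' (by omega) (by omega)

/-! ### Words with one star as contexts -/

/-- A word without `⋆`, as a word on `X ⊔ {⋆}`. -/
def ofWord : BWord X → BWord (Option X)
  | letter x => letter (some x)
  | bracket u => bracket (ofWord u)
  | letterMul x w => letterMul (some x) (ofWord w)
  | bracketMul u w => bracketMul (ofWord u) (ofWord w)

theorem starCount_ofWord (w : BWord X) : (ofWord w).starCount = 0 := by
  induction w <;> simp_all [ofWord, starCount]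

theorem subst_ofWord (u w : BWord X) : subst u (ofWord w) = w := by
  induction w <;> simp_all [ofWord, subst]

theorem exists_eq_ofWord {q : BWord (Option X)} (h : q.starCount = 0) : ∃ w, q = ofWord w := by
  induction q with
  | letter x =>
    cases x with
    | none => simp [starCount] at h
    | some x => exact ⟨letter x, rfl⟩
  | bracket u ih =>
    obtain ⟨v, rfl⟩ := ih h
    exact ⟨v.bracket, rfl⟩
  | letterMul x w ih =>
    cases x with
    | none => simp [starCount] at h
    | some x =>
      obtain ⟨v, rfl⟩ := ih h
      exact ⟨letterMul x v, rfl⟩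
  | bracketMul u w ih ih' =>
    simp only [starCount, Nat.add_eq_zero_iff] at h
    obtain ⟨v, rfl⟩ := ih h.1
    obtain ⟨v', rfl⟩ := ih' h.2
    exact ⟨bracketMul v v', rfl⟩

end BWord

namespace StarWord

open BWord

variable {X : Type u}

/-- The maps `q.app` are among those obtained from the identity by taking brackets and
multiplying with words. -/
theorem app_induction {C : (BWord X → BWord X) → Prop} (star : C fun u => u)
    (bracket : ∀ f, C f → C fun u => (f u).bracket) (left : ∀ a f, C f → C fun u => a * f u)
    (right : ∀ a f, C f → C fun u => f u * a) (q : StarWord X) : C q.app := by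
  obtain ⟨q, hq⟩ := q
  change C fun u => subst u q
  induction q with
  | letter x =>
    cases x with
    | none => exact star
    | some x => simp [starCount] at hq
  | bracket v ih => exact bracket _ (ih hq)
  | letterMul x w ih =>
    cases x with
    | none =>
      obtain ⟨a, rfl⟩ := exists_eq_ofWord (q := w) (by simpa [starCount] using hq)
      simpa only [subst, subst_ofWord] using right a _ star
    | some x => exact left (BWord.letter x) _ (ih hq)
  | bracketMul v w ih ih' =>
    rcases Nat.add_eq_one_iff.1 hq with ⟨hv, hw⟩ | ⟨hv, hw⟩
    · obtain ⟨a, rfl⟩ := exists_eq_ofWord hv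
      simpa only [subst, subst_ofWord, bracket_mul] using left a.bracket _ (ih' hw)
    · obtain ⟨a, rfl⟩ := exists_eq_ofWord hw
      simpa only [subst, subst_ofWord, bracket_mul] using right a _ (bracket _ (ih hv))

theorem pathLt_app (q : StarWord X) {u v : BWord X} (h : PathLt u v) :
    PathLt (q.app u) (q.app v) :=
  app_induction (C := fun f => PathLt (f u) (f v)) h (fun _ h => h.bracket)
    (fun a _ h => h.mul_left a) (fun a _ h => h.mul_right a) q

end StarWord

/-! ### Splitting off a final bracket, and irreducible words -/

namespace BWord

variable {X : Type u}

/-- The words `x` and `y` such that `w = x⌊y⌋`, if there are any. -/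
def splitLast : BWord X → Option (BWord X × BWord X)
  | letter _ => none
  | bracket _ => none
  | letterMul x (bracket y) => some (letter x, y)
  | letterMul x w => (splitLast w).map (Prod.map (letterMul x) id)
  | bracketMul u (bracket y) => some (bracket u, y)
  | bracketMul u w => (splitLast w).map (Prod.map (bracketMul u) id)

theorem splitLast_mul_bracket (x y : BWord X) : splitLast (x * y.bracket) = some (x, y) := by
  induction x with
  | letter x => rfl
  | bracket u _ => rfl
  | letterMul x w ih =>
    rw [letterMul_mul]
    cases w <;> exact congrArg (Option.map _) ih
  | bracketMul u w _ ih =>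
    rw [bracketMul_mul]
    cases w <;> exact congrArg (Option.map _) ih

theorem eq_of_splitLast {w x y : BWord X} (h : splitLast w = some (x, y)) :
    w = x * y.bracket := by
  induction w generalizing x with
  | letter x => cases h
  | bracket u _ => cases h
  | letterMul z w ih =>
    cases w with
    | bracket y' => cases h; rfl
    | letter y' => cases h
    | letterMul _ _ | bracketMul _ _ =>
      obtain ⟨⟨x', y'⟩, h', h''⟩ := Option.map_eq_some_iff.1 h
      cases h''
      rw [ih h']; rfl
  | bracketMul u w _ ih =>
    cases w with
    | bracket y' => cases h; rfl
    | letter y' => cases h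
    | letterMul _ _ | bracketMul _ _ =>
      obtain ⟨⟨x', y'⟩, h', h''⟩ := Option.map_eq_some_iff.1 h
      cases h''
      rw [ih h']; rfl

/-- The number of brackets that are closed at the end of a word. -/
def lastDepth : BWord X → ℕ
  | letter _ => 0
  | bracket u => lastDepth u + 1
  | letterMul _ w => lastDepth w
  | bracketMul _ w => lastDepth w

theorem lastDepth_mul (a b : BWord X) : (a * b).lastDepth = b.lastDepth := by
  induction a with
  | letter x => rfl
  | bracket u _ => rfl
  | letterMul x w ih => exact ih
  | bracketMul u w _ ih => exact ih

theorem deg_lt_deg_mul_bracket (x y : BWord X) : x.deg < (x * y.bracket).deg := by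
  have := deg_pos y
  rw [deg_mul, deg]; omega

theorem lastDepth_mul_lt (m x y : BWord X) :
    (m * y).lastDepth < (x * y.bracket).lastDepth := by
  rw [lastDepth_mul, lastDepth_mul, lastDepth]; omega

/-- The induction follows the recursion for `⌊x⌊y⌋⌋`: passing to `x` lowers the degree, while
passing to `my` with `deg m = deg x` keeps the degree and closes one bracket fewer at the end. -/
theorem splitLast_induction {C : BWord X → Prop} (none : ∀ w, splitLast w = none → C w)
    (some : ∀ x y, C x → (∀ m, m.deg = x.deg → C (m * y)) → C (x * y.bracket)) (w : BWord X) :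
    C w := by
  match h : splitLast w with
  | .none => exact none w h
  | .some (x, y) =>
    rw [eq_of_splitLast h]
    exact some x y (splitLast_induction none some x)
      fun m _ => splitLast_induction none some (m * y)
termination_by (w.deg, w.lastDepth)
decreasing_by
  · rw [eq_of_splitLast h]
    exact Prod.Lex.left _ _ (deg_lt_deg_mul_bracket x y)
  · rename_i hm
    rw [eq_of_splitLast h]
    have : (m * y).deg = (x * y.bracket).deg := by rw [deg_mul, deg_mul, deg, hm]
    rw [this]
    exact Prod.Lex.right _ (lastDepth_mul_lt m x y)

/-- The words that have no bracket of the form `⌊x⌊y⌋⌋`. -/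
def IsIrr : BWord X → Prop
  | letter _ => True
  | bracket u => IsIrr u ∧ splitLast u = none
  | letterMul _ w => IsIrr w
  | bracketMul u w => (IsIrr u ∧ splitLast u = none) ∧ IsIrr w

theorem isIrr_mul {a b : BWord X} : (a * b).IsIrr ↔ a.IsIrr ∧ b.IsIrr := by
  induction a with
  | letter x => exact (true_and _).symm.to_iff
  | bracket u _ => exact Iff.rfl
  | letterMul x w ih => exact ih
  | bracketMul u w _ ih =>
    rw [bracketMul_mul, IsIrr, IsIrr, ih]
    simp only [and_assoc]

/-- A forbidden bracket found by the structural recursion yields the context around it. This is the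
direction needed to show that the normal form fixes `IrrSmrbr`. -/
theorem isIrr_of_mem_irrSmrbr {w : BWord X} (hw : w ∈ IrrSmrbr X) : w.IsIrr := by
  by_contra h
  refine hw ?_
  clear hw
  induction w with
  | letter x => exact absurd trivial h
  | bracket u ih =>
    by_cases hu : u.IsIrr
    · match hs : splitLast u with
      | none => exact absurd ⟨hu, hs⟩ h
      | some (x, y) =>
        exact ⟨⟨letter none, rfl⟩, x, y, by rw [eq_of_splitLast hs]; rfl⟩
    · obtain ⟨q, x, y, rfl⟩ := ih hu
      exact ⟨⟨bracket q.1, q.2⟩, x, y, rfl⟩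
  | letterMul z w ih =>
    obtain ⟨q, x, y, rfl⟩ := ih h
    exact ⟨⟨letterMul (some z) q.1, q.2⟩, x, y, rfl⟩
  | bracketMul u w ih ih' =>
    by_cases hw : w.IsIrr
    · by_cases hu : u.IsIrr
      · match hs : splitLast u with
        | none => exact absurd ⟨⟨hu, hs⟩, hw⟩ h
        | some (x, y) =>
          refine ⟨⟨letterMul none (ofWord w), by simp [starCount, starCount_ofWord]⟩, x, y, ?_⟩
          rw [eq_of_splitLast hs]
          simp only [StarWord.app, subst, subst_ofWord]
          rfl
      · obtain ⟨q, x, y, rfl⟩ := ih hu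
        refine ⟨⟨bracketMul q.1 (ofWord w), by simp [starCount, starCount_ofWord, q.2]⟩, x, y, ?_⟩
        simp only [StarWord.app, subst, subst_ofWord]
    · obtain ⟨q, x, y, rfl⟩ := ih' hw
      refine ⟨⟨bracketMul (ofWord u) q.1, by simp [starCount, starCount_ofWord, q.2]⟩, x, y, ?_⟩
      simp only [StarWord.app, subst, subst_ofWord]

/-- The value of a word in a set with a multiplication and an operator `Q`. -/
def eval {A : Type w} [Mul A] (Q : A → A) (φ : X → A) : BWord X → A
  | letter x => φ x
  | bracket u => Q (eval Q φ u)
  | letterMul x w => φ x * eval Q φ w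
  | bracketMul u w => Q (eval Q φ u) * eval Q φ w

theorem eval_mul {A : Type w} [Semigroup A] (Q : A → A) (φ : X → A) (a b : BWord X) :
    (a * b).eval Q φ = a.eval Q φ * b.eval Q φ := by
  induction a with
  | letter x => rfl
  | bracket u _ => rfl
  | letterMul x w ih => rw [letterMul_mul, eval, eval, ih, mul_assoc]
  | bracketMul u w _ ih => rw [bracketMul_mul, eval, eval, ih, mul_assoc]

end BWord

/-! ### The operator on irreducible words -/

noncomputable section

namespace WordAlg

open BWord

variable {k : Type v} [CommRing k] {X : Type u}

theorem word_mul_word (a b : BWord X) : word k a * word k b = word k (a * b) := by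
  simp [word]

theorem op_word (a : BWord X) : op k X (word k a) = word k a.bracket := by
  simp [op, word]

theorem induction_on {C : WordAlg k X → Prop} (s : WordAlg k X) (zero : C 0)
    (add : ∀ s t, C s → C t → C (s + t)) (smul_word : ∀ (c : k) w, C (c • word k w)) : C s := by
  refine MonoidAlgebra.induction_linear s zero add fun w c => ?_
  simpa [word] using smul_word c w

/-- The linear extension of a map that is defined on words. -/
def extend {M : Type*} [AddCommGroup M] [Module k M] (g : BWord X → M) : WordAlg k X →ₗ[k] M :=
  Finsupp.linearCombination k g ∘ₗ (MonoidAlgebra.coeffLinearEquiv k).toLinearMap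

theorem extend_word {M : Type*} [AddCommGroup M] [Module k M] (g : BWord X → M) (w : BWord X) :
    extend (k := k) g (word k w) = g w := by
  simp [extend, word]

theorem extend_apply {M : Type*} [AddCommGroup M] [Module k M] (g : BWord X → M)
    (s : WordAlg k X) : extend g s = ∑ m ∈ s.coeff.support, s.coeff m • g m := rfl

theorem supported_le {M : Submodule k (WordAlg k X)} {T : Set (BWord X)}
    (h : ∀ w ∈ T, word k w ∈ M) : MonoidAlgebra.supported k k T ≤ M := by
  rw [MonoidAlgebra.supported_eq_span_single, Submodule.span_le]
  rintro _ ⟨w, hw, rfl⟩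
  exact h w hw

theorem word_mem_supported {T : Set (BWord X)} {w : BWord X} (h : w ∈ T) :
    word k w ∈ MonoidAlgebra.supported k k T := by
  rw [MonoidAlgebra.supported_eq_span_single]
  exact Submodule.subset_span ⟨w, h, rfl⟩

theorem mul_mem_supported {T U V : Set (BWord X)} (h : ∀ a ∈ T, ∀ b ∈ U, a * b ∈ V)
    {s t : WordAlg k X} (hs : s ∈ MonoidAlgebra.supported k k T)
    (ht : t ∈ MonoidAlgebra.supported k k U) : s * t ∈ MonoidAlgebra.supported k k V := by
  have h1 : ∀ a ∈ T, MonoidAlgebra.supported k k U ≤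
      (MonoidAlgebra.supported k k V).comap (LinearMap.mulLeft k (word k a)) := fun a ha =>
    supported_le fun b hb => by
      simpa [word_mul_word] using word_mem_supported (k := k) (h a ha b hb)
  have h2 : MonoidAlgebra.supported k k T ≤
      (MonoidAlgebra.supported k k V).comap (LinearMap.mulRight k t) :=
    supported_le fun a ha => h1 a ha ht
  exact h2 hs

/-- The operator on irreducible words: it sends `w` to `⌊w⌋` unless `w = x⌊y⌋`, in which case
`⌊x⌊y⌋⌋` is replaced by `⌊x⌋⌊y⌋ - λ xy - ⌊⌊x⌋y⌋`. -/
def irrOpWord (lam : k) (w : BWord X) : WordAlg k X :=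
  match _h : splitLast w with
  | none => word k w.bracket
  | some (x, y) => irrOpWord lam x * word k y.bracket - lam • word k (x * y) -
      ∑ m ∈ (irrOpWord lam x).coeff.support,
        -- The degree test is there for termination. It always succeeds, by `irrOpWord_mem`, so the
        -- sum is the operator applied to `irrOpWord lam x` times `y`.
        if _hm : m.deg = x.deg then (irrOpWord lam x).coeff m • irrOpWord lam (m * y) else 0
termination_by (w.deg, w.lastDepth)
decreasing_by
  all_goals
    have h := eq_of_splitLast _h
    subst h
  any_goals exact Prod.Lex.left x.lastDepth _ (deg_lt_deg_mul_bracket x y)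
  have : (m * y).deg = (x * y.bracket).deg := by rw [deg_mul, deg_mul, deg, _hm]
  rw [this]
  exact Prod.Lex.right _ (lastDepth_mul_lt m x y)

theorem irrOpWord_of_splitLast_eq_none (lam : k) {w : BWord X} (h : splitLast w = none) :
    irrOpWord lam w = word k w.bracket := by
  rw [irrOpWord.eq_def]
  split
  · rfl
  · simp_all

theorem irrOpWord_mul_bracket_aux (lam : k) (x y : BWord X) :
    irrOpWord lam (x * y.bracket) =
      irrOpWord lam x * word k y.bracket - lam • word k (x * y) -
        ∑ m ∈ (irrOpWord lam x).coeff.support,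
          if m.deg = x.deg then (irrOpWord lam x).coeff m • irrOpWord lam (m * y) else 0 := by
  have h := splitLast_mul_bracket x y
  rw [irrOpWord.eq_def]
  split
  · simp_all
  · rename_i x' y' h'
    rw [h] at h'
    cases h'
    rfl

/-- Homogeneity in the degree and preservation of irreducibility are proved together: homogeneity
makes the induction hypothesis available for the words `my`. -/
theorem irrOpWord_mem (lam : k) (w : BWord X) : irrOpWord lam w ∈
    MonoidAlgebra.supported k k {m | m.deg = w.deg ∧ (w.IsIrr → m.IsIrr)} := by
  induction w using splitLast_induction with
  | none w h =>
    rw [irrOpWord_of_splitLast_eq_none lam h]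
    exact word_mem_supported ⟨rfl, fun hw => ⟨hw, h⟩⟩
  | some x y ih ih' =>
    rw [irrOpWord_mul_bracket_aux]
    refine sub_mem (sub_mem ?_ (Submodule.smul_mem _ _ ?_)) (sum_mem fun m hm => ?_)
    · refine mul_mem_supported (U := {y.bracket}) ?_ ih (word_mem_supported rfl)
      rintro a ⟨ha, ha'⟩ b rfl
      refine ⟨by rw [deg_mul, deg_mul, ha], fun h => ?_⟩
      rw [isIrr_mul] at h ⊢
      exact ⟨ha' h.1, h.2⟩
    · refine word_mem_supported ⟨by rw [deg_mul, deg_mul, deg], fun h => ?_⟩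
      rw [isIrr_mul] at h ⊢
      exact ⟨h.1, h.2.1⟩
    · have hm' := ih hm
      rw [if_pos hm'.1]
      refine Submodule.smul_mem _ _ (MonoidAlgebra.supported_mono ?_ (ih' m hm'.1))
      rintro a ⟨ha, ha'⟩
      refine ⟨by rw [ha, deg_mul, deg_mul, hm'.1, deg], fun h => ha' ?_⟩
      rw [isIrr_mul] at h ⊢
      exact ⟨hm'.2 h.1, h.2.1⟩

/-- The linear operator that makes the span of the irreducible words a modified Rota–Baxter
algebra. -/
def irrOp (lam : k) : WordAlg k X →ₗ[k] WordAlg k X := extend (irrOpWord lam)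

theorem irrOp_word_of_splitLast_eq_none (lam : k) {w : BWord X} (h : splitLast w = none) :
    irrOp lam (word k w) = word k w.bracket := by
  rw [irrOp, extend_word, irrOpWord_of_splitLast_eq_none lam h]

theorem irrOp_word_mul_bracket (lam : k) (x y : BWord X) :
    irrOp lam (word k (x * y.bracket)) = irrOp lam (word k x) * word k y.bracket
      - lam • word k (x * y) - irrOp lam (irrOp lam (word k x) * word k y) := by
  have key : ∀ s : WordAlg k X, irrOp lam (s * word k y) =
      extend (fun m => irrOpWord lam (m * y)) s := by
    intro s
    induction s using induction_on with
    | zero => simp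
    | add s t hs ht => rw [add_mul, map_add, map_add, hs, ht]
    | smul_word c w =>
      rw [smul_mul_assoc, map_smul, map_smul, word_mul_word, extend_word, irrOp, extend_word]
  rw [key, irrOp, extend_word, extend_word, extend_apply, irrOpWord_mul_bracket_aux]
  congr 1
  exact Finset.sum_congr rfl fun m hm => if_pos (irrOpWord_mem lam x hm).1

/-- This is the defining recursion rearranged and extended linearly in `a`: the modified Rota–Baxter
identity with `⌊y⌋` in place of the operator applied to `y`. -/
theorem irrOp_mul_word_bracket (lam : k) (a : WordAlg k X) (y : BWord X) :
    irrOp lam a * word k y.bracket =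
      irrOp lam (irrOp lam a * word k y) + irrOp lam (a * word k y.bracket)
        + lam • (a * word k y) := by
  induction a using induction_on with
  | zero => simp
  | add s t hs ht =>
    simp only [add_mul, map_add, smul_add, hs, ht]
    abel
  | smul_word c x =>
    simp only [smul_mul_assoc, map_smul, word_mul_word, irrOp_word_mul_bracket]
    module

theorem irrOp_mem_supported (lam : k) {s : WordAlg k X}
    (hs : s ∈ MonoidAlgebra.supported k k {w | w.IsIrr}) :
    irrOp lam s ∈ MonoidAlgebra.supported k k {w | w.IsIrr} := by
  have h : MonoidAlgebra.supported k k {w | w.IsIrr} ≤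
      (MonoidAlgebra.supported k k {w : BWord X | w.IsIrr}).comap (irrOp lam) :=
    supported_le fun w hw => by
      rw [Submodule.mem_comap, irrOp, extend_word]
      exact MonoidAlgebra.supported_mono (fun m hm => hm.2 hw) (irrOpWord_mem lam w)
  exact h hs

/-- The elements `b` such that the modified Rota–Baxter identity for the operator `irrOp lam` holds
for all pairs `a, b`. -/
def rotaBaxterRight (lam : k) (X : Type u) : Submodule k (WordAlg k X) where
  carrier := {b | ∀ a, irrOp lam a * irrOp lam b =
    irrOp lam (irrOp lam a * b + a * irrOp lam b) + lam • (a * b)}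
  zero_mem' := by simp
  add_mem' := by
    intro b b' h h' a
    simp only [map_add, mul_add, h a, h' a, smul_add]
    abel
  smul_mem' := by
    intro c b h a
    simp only [map_smul, mul_smul_comm, h a, map_add, smul_add, smul_comm c lam]

/-- If `b` does not end in a bracket, the operator just brackets it and the rearranged recursion is
the identity. For `b = x⌊y⌋`, expand the operator on `b` and use the identity for `x` and for each
`my` with `m` occurring in the image of `x`. -/
theorem word_mem_rotaBaxterRight (lam : k) {b : BWord X} (hb : b.IsIrr) :
    word k b ∈ rotaBaxterRight lam X := by
  induction b using splitLast_induction with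
  | none b h =>
    intro a
    rw [irrOp_word_of_splitLast_eq_none lam h, irrOp_mul_word_bracket, map_add]
  | some x y ih ih' =>
    obtain ⟨hx, hy, hy'⟩ := isIrr_mul.1 hb
    have hxy : irrOp lam (word k x) * word k y ∈ rotaBaxterRight lam X := by
      have h : irrOp lam (word k x) * word k y ∈ MonoidAlgebra.supported k k
          {w | ∃ m : BWord X, m.deg = x.deg ∧ m.IsIrr ∧ w = m * y} := by
        have hm := irrOpWord_mem lam x
        rw [← extend_word (k := k) (irrOpWord lam) x] at hm
        refine mul_mem_supported (U := {y}) ?_ hm (word_mem_supported rfl)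
        rintro m ⟨hm, hm'⟩ _ rfl
        exact ⟨m, hm, hm' hx, rfl⟩
      refine supported_le ?_ h
      rintro _ ⟨m, hm, hm', rfl⟩
      exact ih' m hm (isIrr_mul.2 ⟨hm', hy⟩)
    intro a
    have h1 := ih hx a
    have h2 := hxy a
    have h3 := fun c : WordAlg k X => irrOp_mul_word_bracket lam c y
    have h4 : irrOp lam a * irrOp lam (word k (x * y.bracket)) =
        irrOp lam a * irrOp lam (word k x) * word k y.bracket
        - irrOp lam a * irrOp lam (irrOp lam (word k x) * word k y)
        - lam • (irrOp lam a * word k x * word k y) := by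
      rw [irrOp_word_mul_bracket, mul_sub, mul_sub, mul_smul_comm, ← word_mul_word]
      simp only [mul_assoc]
      abel
    have h5 := irrOp_word_mul_bracket lam x y
    rw [h4, h1, h2, h5, ← word_mul_word x y.bracket, ← word_mul_word x y]
    -- `h3` removes every factor `⌊y⌋` standing to the right of a value of the operator. This
    -- creates new products of the values at `a` and `x`, to which `h1` is applied once more; the
    -- rest is linear.
    simp only [add_mul, h3, map_add, map_sub, map_smul, mul_sub, mul_add, smul_mul_assoc,
      mul_smul_comm, mul_assoc] at h1 ⊢
    simp only [← mul_assoc (irrOp lam a) (irrOp lam (word k x)), h1, add_mul, map_add, map_smul,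
      smul_mul_assoc, mul_assoc]
    module

theorem mem_rotaBaxterRight (lam : k) {b : WordAlg k X}
    (hb : b ∈ MonoidAlgebra.supported k k {w | w.IsIrr}) : b ∈ rotaBaxterRight lam X :=
  supported_le (fun _ hw => word_mem_rotaBaxterRight lam hw) hb

end WordAlg

end

/-! ### Contexts, evaluation and the normal form -/

noncomputable section

namespace WordAlg

open BWord

variable {k : Type v} [CommRing k] {X : Type u}

theorem mapDomain_word (f : BWord X → BWord X) (w : BWord X) :
    MonoidAlgebra.mapDomain f (word k w) = word k (f w) := by
  simp [word]

theorem app_word (q : StarWord X) (w : BWord X) : app q (word k w) = word k (q.app w) :=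
  mapDomain_word _ w

theorem mapDomain_id (s : WordAlg k X) : MonoidAlgebra.mapDomain (fun u => u) s = s :=
  congrArg MonoidAlgebra.ofCoeff Finsupp.mapDomain_id

theorem mapDomain_bracket (f : BWord X → BWord X) (s : WordAlg k X) :
    MonoidAlgebra.mapDomain (fun u => (f u).bracket) s = op k X (MonoidAlgebra.mapDomain f s) := by
  induction s using induction_on with
  | zero => simp
  | add s t hs ht => simp only [MonoidAlgebra.mapDomain_add, hs, ht, map_add]
  | smul_word c w => simp only [MonoidAlgebra.mapDomain_smul, mapDomain_word, map_smul, op_word]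

theorem mapDomain_mul_left (a : BWord X) (f : BWord X → BWord X) (s : WordAlg k X) :
    MonoidAlgebra.mapDomain (fun u => a * f u) s = word k a * MonoidAlgebra.mapDomain f s := by
  induction s using induction_on with
  | zero => simp
  | add s t hs ht => simp only [MonoidAlgebra.mapDomain_add, hs, ht, mul_add]
  | smul_word c w =>
    simp only [MonoidAlgebra.mapDomain_smul, mapDomain_word, mul_smul_comm, word_mul_word]

theorem mapDomain_mul_right (a : BWord X) (f : BWord X → BWord X) (s : WordAlg k X) :
    MonoidAlgebra.mapDomain (fun u => f u * a) s = MonoidAlgebra.mapDomain f s * word k a := by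
  induction s using induction_on with
  | zero => simp
  | add s t hs ht => simp only [MonoidAlgebra.mapDomain_add, hs, ht, add_mul]
  | smul_word c w =>
    simp only [MonoidAlgebra.mapDomain_smul, mapDomain_word, smul_mul_assoc, word_mul_word]

theorem app_mem_of_isOperatedIdeal {I : Submodule k (WordAlg k X)}
    (hI : IsOperatedIdeal (op k X) I) (q : StarWord X) {s : WordAlg k X} (hs : s ∈ I) :
    app q s ∈ I := by
  refine StarWord.app_induction (C := fun f => MonoidAlgebra.mapDomain f s ∈ I)
    ?_ (fun f hf => ?_) (fun a f hf => ?_) (fun a f hf => ?_) q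
  · rwa [mapDomain_id]
  · rw [mapDomain_bracket]; exact hI.2.2 _ hf
  · rw [mapDomain_mul_left]; exact hI.1 _ _ hf
  · rw [mapDomain_mul_right]; exact hI.2.1 _ _ hf

section Lift

variable {A : Type w} [NonUnitalRing A] [Module k A] [IsScalarTower k A A] [SMulCommClass k A A]

/-- The homomorphism from the free operated algebra that extends a map from `X` to an operated
algebra. -/
def liftHom (Q : A →ₗ[k] A) (φ : X → A) : WordAlg k X →ₙₐ[k] A :=
  MonoidAlgebra.liftMagma k ⟨eval Q φ, eval_mul Q φ⟩

variable (Q : A →ₗ[k] A) (φ : X → A)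

theorem liftHom_word (w : BWord X) : liftHom Q φ (word k w) = eval Q φ w := by
  simp [liftHom, word]

theorem liftHom_op (s : WordAlg k X) : liftHom Q φ (op k X s) = Q (liftHom Q φ s) := by
  induction s using induction_on with
  | zero => simp
  | add s t hs ht => simp only [map_add, hs, ht]
  | smul_word c w => simp only [map_smul, op_word, liftHom_word, eval]

theorem liftHom_eq_zero {S : Set (WordAlg k X)} (hS : ∀ s ∈ S, liftHom Q φ s = 0)
    {t : WordAlg k X} (ht : t ∈ operatedIdeal (op k X) S) : liftHom Q φ t = 0 := by
  have h : operatedIdeal (op k X) S ≤ LinearMap.ker (liftHom Q φ : WordAlg k X →ₗ[k] A) := by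
    refine sInf_le ⟨⟨fun a b hb => ?_, fun a b hb => ?_, fun b hb => ?_⟩, fun s hs => hS s hs⟩
    all_goals
      replace hb : liftHom Q φ b = 0 := hb
      rw [LinearMap.mem_ker]
    · change liftHom Q φ (a * b) = 0
      rw [map_mul, hb, mul_zero]
    · change liftHom Q φ (b * a) = 0
      rw [map_mul, hb, zero_mul]
    · change liftHom Q φ (op k X b) = 0
      rw [liftHom_op, hb, map_zero]
  exact h ht

theorem liftHom_mrbElem {lam : k} {x y : BWord X}
    (h : Q (eval Q φ x) * Q (eval Q φ y) =
      Q (Q (eval Q φ x) * eval Q φ y + eval Q φ x * Q (eval Q φ y))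
        + lam • (eval Q φ x * eval Q φ y)) :
    liftHom Q φ (mrbElem lam x y) = 0 := by
  simp only [mrbElem, leadWord, map_sub, map_add, map_smul, liftHom_word, eval, eval_mul] at h ⊢
  rw [h]
  abel

end Lift

/-- The normal form with respect to the relations `⌊x⌊y⌋⌋ = ⌊x⌋⌊y⌋ - λ xy - ⌊⌊x⌋y⌋`. -/
def normalForm (lam : k) (X : Type u) : WordAlg k X →ₙₐ[k] WordAlg k X :=
  liftHom (irrOp lam) fun x => word k (letter x)

theorem eval_irrOp_mem_supported (lam : k) (w : BWord X) :
    eval (irrOp lam) (fun x => word k (letter x)) w ∈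
      MonoidAlgebra.supported k k {w : BWord X | w.IsIrr} := by
  have hmul : ∀ a ∈ {w : BWord X | w.IsIrr}, ∀ b ∈ {w : BWord X | w.IsIrr},
      a * b ∈ {w : BWord X | w.IsIrr} := fun a ha b hb => isIrr_mul.2 ⟨ha, hb⟩
  induction w with
  | letter x => exact word_mem_supported trivial
  | bracket u ih => exact irrOp_mem_supported lam ih
  | letterMul x w ih => exact mul_mem_supported hmul (word_mem_supported trivial) ih
  | bracketMul u w ih ih' => exact mul_mem_supported hmul (irrOp_mem_supported lam ih) ih'

theorem eval_irrOp_of_isIrr (lam : k) {w : BWord X} (h : w.IsIrr) :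
    eval (irrOp lam) (fun x => word k (letter x)) w = word k w := by
  induction w with
  | letter x => rfl
  | bracket u ih => rw [eval, ih h.1, irrOp_word_of_splitLast_eq_none lam h.2]
  | letterMul x w ih => rw [eval, ih h, word_mul_word]; rfl
  | bracketMul u w ih ih' =>
    rw [eval, ih h.1.1, ih' h.2, irrOp_word_of_splitLast_eq_none lam h.1.2, word_mul_word]
    rfl

theorem normalForm_eq_zero (lam : k) {s : WordAlg k X}
    (hs : s ∈ operatedIdeal (op k X) (Smrbr lam X)) : normalForm lam X s = 0 := by
  refine liftHom_eq_zero _ _ ?_ hs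
  rintro _ ⟨x, y, rfl⟩
  exact liftHom_mrbElem _ _ (mem_rotaBaxterRight lam (eval_irrOp_mem_supported lam y) _)

/-- The normal form fixes `s` because `s` is a combination of irreducible words, and kills it
because `s` lies in the ideal. -/
theorem eq_zero_of_mem_operatedIdeal (lam : k) {s : WordAlg k X}
    (hs : s ∈ operatedIdeal (op k X) (Smrbr lam X))
    (hs' : s ∈ MonoidAlgebra.supported k k (IrrSmrbr X)) : s = 0 := by
  have h : MonoidAlgebra.supported k k (IrrSmrbr X) ≤ LinearMap.eqLocus
      (normalForm lam X : WordAlg k X →ₗ[k] WordAlg k X) LinearMap.id :=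
    supported_le fun w hw => by
      change normalForm lam X (word k w) = word k w
      rw [normalForm, liftHom_word, eval_irrOp_of_isIrr lam (isIrr_of_mem_irrSmrbr hw)]
  have h' : normalForm lam X s = s := h hs'
  rw [← h', normalForm_eq_zero lam hs]

theorem subset_operatedIdeal {A : Type w} [NonUnitalRing A] [Module k A] (P : A →ₗ[k] A)
    (S : Set A) : S ⊆ operatedIdeal P S := fun s hs => by
  simp only [operatedIdeal, SetLike.mem_coe, Submodule.mem_sInf]
  exact fun I hI => hI.2 hs

theorem app_mrbElem_mem_operatedIdeal (lam : k) (q : StarWord X) (x y : BWord X) :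
    app q (mrbElem lam x y) ∈ operatedIdeal (op k X) (Smrbr lam X) :=
  app_mem_of_isOperatedIdeal (isOperatedIdeal_operatedIdeal _ _) q
    (subset_operatedIdeal _ _ ⟨x, y, rfl⟩)

theorem app_mrbElem_sub_mem_supported (lam : k) (q : StarWord X) (x y : BWord X) :
    app q (mrbElem lam x y) - word k (q.app (leadWord x y)) ∈
      MonoidAlgebra.supported k k {m | PathLt m (q.app (leadWord x y))} := by
  have h : app q (mrbElem lam x y) - word k (q.app (leadWord x y)) =
      word k (q.app (x.bracket * y).bracket) + lam • word k (q.app (x * y))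
        - word k (q.app (x.bracket * y.bracket)) := by
    have hl : ∀ s, app (k := k) q s = MonoidAlgebra.mapDomainLinearMap k k q.app s := fun _ => rfl
    simp only [mrbElem, hl, map_sub, map_add, map_smul]
    simp only [← hl, app_word]
    abel
  rw [h]
  exact sub_mem (add_mem
    (word_mem_supported (q.pathLt_app (pathLt_bracket_mul_leadWord x y)))
    (Submodule.smul_mem _ _ (word_mem_supported (q.pathLt_app (pathLt_mul_leadWord x y)))))
    (word_mem_supported (q.pathLt_app (pathLt_bracket_mul_bracket_leadWord x y)))

theorem mrbElem_sub_mem_supported (lam : k) (x y : BWord X) :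
    mrbElem lam x y - word k (leadWord x y) ∈
      MonoidAlgebra.supported k k {m | PathLt m (leadWord x y)} := by
  have h := app_mrbElem_sub_mem_supported lam ⟨letter none, rfl⟩ x y
  have : app ⟨letter none, rfl⟩ (mrbElem lam x y) = mrbElem lam x y := mapDomain_id _
  rwa [this] at h

theorem isLeadingMonomial_unique {le : BWord X → BWord X → Prop} {s : WordAlg k X}
    {a b : BWord X} (ha : IsLeadingMonomial le s a) (hb : IsLeadingMonomial le s b) : a = b := by
  by_contra h
  exact (ha.2 b hb.1 (Ne.symm h)).2 (hb.2 a ha.1 h).1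

/-! ### Leading monomials, reduction and compositions -/

section Order

variable [LinearOrder X] [WellFoundedLT X]

/-- No word is `PathLt` itself, so the remainder cannot disturb the coefficient of `m`, even if its
own terms coincide or cancel. -/
theorem isLeadingMonomial_of_sub_mem [Nontrivial k] {s : WordAlg k X} {m : BWord X}
    (h : s - word k m ∈ MonoidAlgebra.supported k k {m' | PathLt m' m}) :
    IsLeadingMonomial lePLr s m ∧ s.coeff m = 1 := by
  have h1 : ∀ m' : BWord X, ¬ PathLt m' m → s.coeff m' = (word k m).coeff m' := by
    intro m' hm'
    have := MonoidAlgebra.mem_supported'.1 h m' hm'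
    rwa [MonoidAlgebra.coeff_sub, Finsupp.sub_apply, sub_eq_zero] at this
  have h2 : s.coeff m = 1 := by
    rw [h1 m fun h => h.ne rfl]; simp [word]
  refine ⟨⟨by simp [h2], fun m' hm' hne => ?_⟩, h2⟩
  by_contra hlt
  have := h1 m' fun h => hlt h.strictPart
  rw [Finsupp.mem_support_iff, this] at hm'
  exact hm' (by simp [word, hne.symm])

/-- Reduction of the words in a lower set `D` to irreducible words. -/
theorem word_mem_supported_sup (lam : k) {D : Set (BWord X)} {J : Submodule k (WordAlg k X)}
    (hD : ∀ m ∈ D, ∀ m', StrictPart lePLr m' m → m' ∈ D)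
    (hJ : ∀ q x y, q.app (leadWord x y) ∈ D → app q (mrbElem lam x y) ∈ J) {m : BWord X}
    (hm : m ∈ D) : word k m ∈ MonoidAlgebra.supported k k (IrrSmrbr X) ⊔ J := by
  induction m using (wellFounded_strictPart (X := X)).induction with
  | _ m ih =>
    by_cases h : m ∈ IrrSmrbr X
    · exact Submodule.mem_sup_left (word_mem_supported h)
    · obtain ⟨q, x, y, rfl⟩ := not_not.1 h
      have h1 : app q (mrbElem lam x y) - word k (q.app (leadWord x y)) ∈
          MonoidAlgebra.supported k k (IrrSmrbr X) ⊔ J :=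
        supported_le (fun m' hm' => ih m' hm'.strictPart (hD _ hm m' hm'.strictPart))
          (app_mrbElem_sub_mem_supported lam q x y)
      have h2 := sub_mem (Submodule.mem_sup_right (hJ q x y hm)) h1
      rwa [sub_sub_cancel] at h2

theorem supported_sup_operatedIdeal (lam : k) :
    MonoidAlgebra.supported k k (IrrSmrbr X) ⊔ operatedIdeal (op k X) (Smrbr lam X) = ⊤ := by
  refine top_le_iff.1 fun s _ => ?_
  have h : s ∈ MonoidAlgebra.supported k k (Set.univ : Set (BWord X)) :=
    MonoidAlgebra.mem_supported.2 (Set.subset_univ _)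
  exact supported_le (fun m hm => word_mem_supported_sup lam (D := Set.univ)
    (fun _ _ _ _ => trivial) (fun q x y _ => app_mrbElem_mem_operatedIdeal lam q x y) hm) h

/-- Reduction below `w` writes `s` as an irreducible part plus a trivial part. Both `s` and the
trivial part lie in `Id(S)`, so the irreducible part does too and vanishes. -/
theorem isTrivialMod_of_mem [Nontrivial k] (lam : k) {w : BWord X} {s : WordAlg k X}
    (hs : s ∈ MonoidAlgebra.supported k k {m | StrictPart lePLr m w})
    (hs' : s ∈ operatedIdeal (op k X) (Smrbr lam X)) :
    IsTrivialMod lePLr (Smrbr lam X) w s := by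
  have h1 := supported_le (fun m hm => word_mem_supported_sup lam
    (J := Submodule.span k {g : WordAlg k X | ∃ (q : StarWord X) (s : WordAlg k X) (m : BWord X),
      s ∈ Smrbr lam X ∧ g = app q s ∧ IsLeadingMonomial lePLr g m ∧ StrictPart lePLr m w})
    (D := {m | StrictPart lePLr m w}) (fun _ hm _ hm' => strictPart_trans hm' hm)
    (fun q x y h => Submodule.subset_span ⟨q, _, _, ⟨x, y, rfl⟩, rfl,
      (isLeadingMonomial_of_sub_mem (app_mrbElem_sub_mem_supported lam q x y)).1, h⟩) hm) hs
  obtain ⟨r, hr, t, ht, rfl⟩ := Submodule.mem_sup.1 h1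
  have h2 : t ∈ operatedIdeal (op k X) (Smrbr lam X) := by
    refine Submodule.span_le.2 ?_ ht
    rintro _ ⟨q, _, _, ⟨x, y, rfl⟩, rfl, -⟩
    exact app_mrbElem_mem_operatedIdeal lam q x y
  have h3 : r = 0 := eq_zero_of_mem_operatedIdeal lam (by simpa using sub_mem hs' h2) hr
  rw [h3, zero_add]
  exact ht

theorem isGroebnerShirshovBasis_Smrbr [Nontrivial k] (lam : k) :
    IsGroebnerShirshovBasis lePLr (Smrbr lam X) where
  monic := by
    rintro _ ⟨x, y, rfl⟩
    exact ⟨_, isLeadingMonomial_of_sub_mem (mrbElem_sub_mem_supported lam x y)⟩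
  intersection := by
    rintro _ ⟨x, y, rfl⟩ _ ⟨x', y', rfl⟩ a b w u v ha hb hw - - hlt
    obtain rfl := isLeadingMonomial_unique ha
      (isLeadingMonomial_of_sub_mem (mrbElem_sub_mem_supported lam x y)).1
    obtain rfl := isLeadingMonomial_unique hb
      (isLeadingMonomial_of_sub_mem (mrbElem_sub_mem_supported lam x' y')).1
    -- Leading words are single brackets, so their breadths add up to `2`, while `w = au` has
    -- breadth at least `2`: there are no intersection compositions.
    have := breadth_pos u
    rw [hw, breadth_mul, leadWord, leadWord, breadth, breadth] at hlt
    omega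
  including := by
    rintro _ ⟨x, y, rfl⟩ _ ⟨x', y', rfl⟩ a b q ha hb hab
    obtain rfl := isLeadingMonomial_unique ha
      (isLeadingMonomial_of_sub_mem (mrbElem_sub_mem_supported lam x y)).1
    obtain rfl := isLeadingMonomial_unique hb
      (isLeadingMonomial_of_sub_mem (mrbElem_sub_mem_supported lam x' y')).1
    refine isTrivialMod_of_mem lam ?_ (sub_mem (subset_operatedIdeal _ _ ⟨x, y, rfl⟩)
      (app_mrbElem_mem_operatedIdeal lam q x' y'))
    have h := app_mrbElem_sub_mem_supported lam q x' y'
    rw [← hab] at h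
    -- Both elements have the same leading word with coefficient `1`; it cancels in the difference.
    have h' := sub_mem (mrbElem_sub_mem_supported lam x y) h
    rw [sub_sub_sub_cancel_right] at h'
    exact MonoidAlgebra.supported_mono (fun m hm => PathLt.strictPart hm) h'

end Order

end WordAlg

/-! ### The quotient: freeness and basis -/

namespace OperatedQuotient

open BWord WordAlg

variable {k : Type v} [CommRing k] {X : Type u}

theorem mk_eq_zero {A : Type w} [NonUnitalRing A] [Module k A] (P : A →ₗ[k] A) (S : Set A)
    {a : A} : mk P S a = 0 ↔ a ∈ operatedIdeal P S :=
  Submodule.Quotient.mk_eq_zero _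

/-- The identity is bilinear, so it suffices to check it on classes of words, where it says that the
class of `mrbElem` is zero. -/
theorem isModifiedRotaBaxter_op (lam : k) :
    IsModifiedRotaBaxter lam (op (WordAlg.op k X) (Smrbr lam X)) := by
  intro x y
  obtain ⟨a, rfl⟩ := mk_surjective _ _ x
  obtain ⟨b, rfl⟩ := mk_surjective _ _ y
  induction a using WordAlg.induction_on with
  | zero => simp
  | add s t hs ht =>
    simp only [map_add, add_mul, smul_add] at hs ht ⊢
    rw [hs, ht]; abel
  | smul_word c x =>
    simp only [map_smul, smul_mul_assoc, smul_comm lam c, ← smul_add]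
    congr 1
    induction b using WordAlg.induction_on with
    | zero => simp
    | add s t hs ht =>
      simp only [map_add, mul_add, smul_add] at hs ht ⊢
      rw [hs, ht]; abel
    | smul_word c y =>
      simp only [map_smul, mul_smul_comm, smul_comm lam c, ← smul_add]
      congr 1
      have h : mk (WordAlg.op k X) (Smrbr lam X) (mrbElem lam x y) = 0 :=
        (mk_eq_zero _ _).2 (subset_operatedIdeal _ _ ⟨x, y, rfl⟩)
      simp only [op_mk, ← mk_mul, ← map_add, ← map_smul, op_word, word_mul_word]
      rw [eq_comm, ← sub_eq_zero, ← map_sub, ← h, map_add, op_word, op_word, mrbElem, leadWord]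
      congr 2
      abel

theorem isFreeModifiedRotaBaxter (lam : k) (X : Type u) :
    IsFreeModifiedRotaBaxter.{v, u, max u v, w} lam (op (WordAlg.op k X) (Smrbr lam X))
      (fun x : X => mk (WordAlg.op k X) (Smrbr lam X) (word k (letter x))) := by
  refine ⟨isModifiedRotaBaxter_op lam, fun A _ _ _ _ Q hQ φ => ?_⟩
  have hker : operatedIdeal (WordAlg.op k X) (Smrbr lam X) ≤
      LinearMap.ker (liftHom Q φ : WordAlg k X →ₗ[k] A) := fun s hs => by
    refine liftHom_eq_zero Q φ ?_ hs
    rintro _ ⟨x, y, rfl⟩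
    exact liftHom_mrbElem Q φ (hQ _ _)
  let l : MRBQuotient lam X →ₗ[k] A := (operatedIdeal (WordAlg.op k X) (Smrbr lam X)).liftQ _ hker
  have hl : ∀ s, l (mk _ _ s) = liftHom Q φ s := fun s => rfl
  let h : MRBQuotient lam X →ₙₐ[k] A :=
    { toFun := l
      map_smul' := fun c x => map_smul l c x
      map_zero' := map_zero l
      map_add' := map_add l
      map_mul' := fun x y => by
        obtain ⟨a, rfl⟩ := mk_surjective _ _ x
        obtain ⟨b, rfl⟩ := mk_surjective _ _ y
        rw [← mk_mul, hl, hl, hl, map_mul] }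
  have hh : ∀ s, h (mk _ _ s) = liftHom Q φ s := hl
  refine ⟨h, ⟨fun x => ?_, fun x => ?_⟩, ?_⟩
  · obtain ⟨a, rfl⟩ := mk_surjective _ _ x
    rw [op_mk, hh, hh, liftHom_op]
  · simp only [hh, liftHom_word, eval]
  · rintro g ⟨hg, hg'⟩
    -- Uniqueness: letters generate all words under product and bracket, so `g` is forced on words,
    -- which span.
    have hw : ∀ w : BWord X, g (mk _ _ (word k w)) = eval Q φ w := by
      intro w
      induction w with
      | letter x => exact hg' x
      | bracket u ih => rw [← op_word, ← op_mk, hg, ih, eval]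
      | letterMul x w ih =>
        rw [← letter_mul, ← word_mul_word, mk_mul, map_mul, ih, hg', letter_mul, eval]
      | bracketMul u w ih ih' =>
        rw [← bracket_mul, ← word_mul_word, mk_mul, map_mul, ih', ← op_word, ← op_mk, hg, ih,
          bracket_mul, eval]
    refine NonUnitalAlgHom.ext fun x => ?_
    obtain ⟨a, rfl⟩ := mk_surjective _ _ x
    induction a using WordAlg.induction_on with
    | zero => simp
    | add s t hs ht => rw [map_add, map_add, map_add, hs, ht]
    | smul_word c w => rw [map_smul, map_smul, map_smul, hw, hh, liftHom_word]

/-- Words are independent before passing to the quotient, and the kernel meets the span of the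
irreducible ones trivially. -/
theorem linearIndependent_irrSmrbr (lam : k) (X : Type u) :
    LinearIndependent k (fun a : IrrSmrbr X =>
      mk (WordAlg.op k X) (Smrbr lam X) (word k a.1)) := by
  have h : LinearIndependent k (fun a : IrrSmrbr X => word k a.1) := by
    have := (MonoidAlgebra.basis (BWord X) k).linearIndependent.comp
      (Subtype.val : IrrSmrbr X → BWord X) Subtype.val_injective
    simpa [Function.comp_def, word] using this
  refine h.map (f := mk (WordAlg.op k X) (Smrbr lam X)) (Submodule.disjoint_def.2 fun s hs hs' => ?_)
  refine eq_zero_of_mem_operatedIdeal lam ((mk_eq_zero _ _).1 hs') (Submodule.span_le.2 ?_ hs)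
  rintro _ ⟨a, rfl⟩
  exact word_mem_supported a.2

theorem span_irrSmrbr [LinearOrder X] [WellFoundedLT X] (lam : k) :
    Submodule.span k (Set.range (fun a : IrrSmrbr X =>
      mk (WordAlg.op k X) (Smrbr lam X) (word k a.1))) = ⊤ := by
  refine top_le_iff.1 fun x _ => ?_
  obtain ⟨s, rfl⟩ := mk_surjective _ _ x
  have hs : s ∈ MonoidAlgebra.supported k k (IrrSmrbr X) ⊔
      operatedIdeal (WordAlg.op k X) (Smrbr lam X) := by
    rw [supported_sup_operatedIdeal]; trivial
  obtain ⟨r, hr, t, ht, rfl⟩ := Submodule.mem_sup.1 hs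
  rw [map_add, (mk_eq_zero _ _).2 ht, add_zero]
  have h : MonoidAlgebra.supported k k (IrrSmrbr X) ≤ (Submodule.span k (Set.range
      (fun a : IrrSmrbr X => mk (WordAlg.op k X) (Smrbr lam X) (word k a.1)))).comap (mk _ _) :=
    supported_le fun w hw => Submodule.subset_span ⟨⟨w, hw⟩, rfl⟩
  exact h hr

end OperatedQuotient

end

theorem theorem4p7 {k : Type v} [CommRing k] [CharZero k] {X : Type u} [LinearOrder X]
    [WellFoundedLT X] (lam : k) :
    -- the order: a total preorder whose strict part is well-founded
    ((∀ a b : BWord X, BWord.lePLr a b ∨ BWord.lePLr b a) ∧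
      (∀ a b c : BWord X, BWord.lePLr a b → BWord.lePLr b c → BWord.lePLr a c) ∧
      WellFounded (StrictPart (BWord.lePLr (X := X)))) ∧
    -- the leading monomials, also after insertion into a `⋆`-bracketed word
    (∀ x y : BWord X, IsLeadingMonomial BWord.lePLr (mrbElem lam x y) (leadWord x y)) ∧
    (∀ (q : StarWord X) (x y : BWord X),
      IsLeadingMonomial BWord.lePLr (WordAlg.app q (mrbElem lam x y)) (q.app (leadWord x y))) ∧
    -- the Gröbner–Shirshov basis
    IsGroebnerShirshovBasis BWord.lePLr (Smrbr lam X) ∧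
    -- the quotient is the free nonunitary modified Rota–Baxter algebra on `X`
    IsFreeModifiedRotaBaxter.{v, u, max u v, w} lam
      (OperatedQuotient.op (WordAlg.op k X) (Smrbr lam X))
      (fun x : X => OperatedQuotient.mk (WordAlg.op k X) (Smrbr lam X)
        (WordAlg.word k (BWord.letter x))) ∧
    -- the irreducible words form a basis of it
    LinearIndependent k (fun a : IrrSmrbr X =>
      OperatedQuotient.mk (WordAlg.op k X) (Smrbr lam X) (WordAlg.word k a.1)) ∧
    Submodule.span k (Set.range (fun a : IrrSmrbr X =>
      OperatedQuotient.mk (WordAlg.op k X) (Smrbr lam X) (WordAlg.word k a.1))) = ⊤ := by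
  have : Nontrivial k := nontrivial_of_ne (1 : k) 0 one_ne_zero
  exact ⟨⟨BWord.lePLr_total, BWord.lePLr_trans, BWord.wellFounded_strictPart⟩,
    fun x y => (WordAlg.isLeadingMonomial_of_sub_mem
      (WordAlg.mrbElem_sub_mem_supported lam x y)).1,
    fun q x y => (WordAlg.isLeadingMonomial_of_sub_mem
      (WordAlg.app_mrbElem_sub_mem_supported lam q x y)).1,
    WordAlg.isGroebnerShirshovBasis_Smrbr lam,
    OperatedQuotient.isFreeModifiedRotaBaxter lam X,
    OperatedQuotient.linearIndependent_irrSmrbr lam X,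
    OperatedQuotient.span_irrSmrbr lam⟩
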